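/- There exist absolute constants $c, C, \gamma > 0$ such that the following holds for all $n, m$ with $m \ge cn$. Let $a_1,\dots,a_m$ be i.i.d. $\mathcal{N}(0,I_n)$ random vectors in $\mathbb{R}^n$, and for $\lambda\in\mathbb{R}^m$ put $\mathcal{A}^*(\lambda)=\sum_{i=1}^m \lambda_i a_i a_i^T$. For $x_0\in\mathbb{R}^n$ let $T=\{x x_0^T + x_0 x^T : x\in\mathbb{R}^n\}$, let $T^\perp$ be its orthogonal complement in the space of symmetric $n\times n$ matrices with the inner product $\langle A,B\rangle=\operatorname{tr}(A^TB)$, and let $X_T$ and $X_{T^\perp}$ be the orthogonal projections of a symmetric matrix $X$ onto $T$ and $T^\perp$; write $\|\cdot\|$ for the spectral norm and $\|\cdot\|_F$ for the Frobenius norm. (i) For every fixed $x_0\in\mathbb{R}^n$, with probability at least $1-Ce^{-\gamma m}$ there is $\lambda\in\mathbb{R}^m$ with $\|\lambda\|_\infty\le 7/m$ such that $Y=\mathcal{A}^*(\lambda)$ satisfies $$\Bigl\|Y_{T^\perp}+\tfrac{17}{10}I_{T^\perp}\Bigr\|\le\tfrac1{10}\quad\text{and}\quad \|Y_T\|_F\le\tfrac3{20}.$$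 (ii) If moreover $\|x_0\|_2=1$, one can take the explicit coefficients $$\lambda_i=\frac1m\Bigl[\langle a_i,x_0\rangle^2\,\mathbf 1(|\langle a_i,x_0\rangle|\le 3)-\beta_0\Bigr],\qquad \beta_0=\mathbb{E}\bigl[z^4\,\mathbf 1(|z|\le 3)\bigr],\quad z\sim\mathcal{N}(0,1):$$ they always satisfy $\|\lambda\|_\infty\le 7/m$, and $Y=\mathcal{A}^*(\lambda)$ satisfies the two inequalities of (i) with probability at least $1-Ce^{-\gamma m}$. -/

import Mathlib

open MeasureTheory ProbabilityTheory

noncomputable section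

namespace PhaseLift

/-- Real square matrices, identified entry by entry with a Euclidean space. The Euclidean inner
product of the images of `A` and `B` is the Frobenius inner product `tr (Aᵀ B)`. -/
def vecEquiv (n : ℕ) :
    Matrix (Fin n) (Fin n) ℝ ≃ₗ[ℝ] EuclideanSpace ℝ (Fin n × Fin n) where
  toFun X := WithLp.toLp 2 (fun p => X p.1 p.2)
  invFun v := Matrix.of (fun i j => v (i, j))
  map_add' _ _ := rfl
  map_smul' _ _ := rfl
  left_inv _ := rfl
  right_inv _ := rfl

/-- The orthogonal projection of the matrix `X` onto the linear space `S` of matrices, for the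
Frobenius inner product. -/
def frobProj {n : ℕ} (S : Submodule ℝ (Matrix (Fin n) (Fin n) ℝ))
    (X : Matrix (Fin n) (Fin n) ℝ) : Matrix (Fin n) (Fin n) ℝ :=
  (vecEquiv n).symm
    ((S.map (vecEquiv n : Matrix (Fin n) (Fin n) ℝ →ₗ[ℝ] _)).starProjection (vecEquiv n X))

/-- The space `T = {x x₀ᵀ + x₀ xᵀ : x ∈ ℝⁿ}` of symmetric matrices. -/
def tangentSpace {n : ℕ} (x₀ : EuclideanSpace ℝ (Fin n)) :
    Submodule ℝ (Matrix (Fin n) (Fin n) ℝ) where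
  carrier := {X | ∃ x : EuclideanSpace ℝ (Fin n),
    X = Matrix.vecMulVec x x₀ + Matrix.vecMulVec x₀ x}
  zero_mem' := ⟨0, by simp⟩
  add_mem' := by
    rintro _ _ ⟨x, rfl⟩ ⟨y, rfl⟩
    refine ⟨x + y, ?_⟩
    ext i j
    simp [Matrix.vecMulVec_apply]
    ring
  smul_mem' := by
    rintro r _ ⟨x, rfl⟩
    refine ⟨r • x, ?_⟩
    ext i j
    simp [Matrix.vecMulVec_apply]
    ring

/-- The orthogonal complement `T^⊥` of `T` in the space of symmetric matrices. -/
def tangentPerp {n : ℕ} (x₀ : EuclideanSpace ℝ (Fin n)) :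
    Submodule ℝ (Matrix (Fin n) (Fin n) ℝ) where
  carrier := {X | X.IsSymm ∧ ∀ V ∈ tangentSpace x₀, (V.transpose * X).trace = 0}
  zero_mem' := ⟨Matrix.isSymm_zero, by simp⟩
  add_mem' := by
    rintro X Y ⟨hX, hX'⟩ ⟨hY, hY'⟩
    refine ⟨hX.add hY, fun V hV => ?_⟩
    rw [Matrix.mul_add, Matrix.trace_add, hX' V hV, hY' V hV, add_zero]
  smul_mem' := by
    rintro r X ⟨hX, hX'⟩
    refine ⟨hX.smul r, fun V hV => ?_⟩
    rw [Matrix.mul_smul, Matrix.trace_smul, hX' V hV, smul_zero]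

section

open scoped Matrix.Norms.L2Operator

/-- The spectral norm of a matrix: its operator norm on Euclidean space. -/
def spectralNorm {n : ℕ} (X : Matrix (Fin n) (Fin n) ℝ) : ℝ := ‖X‖

end

section

open scoped Matrix.Norms.Frobenius

/-- The Frobenius norm of a matrix. -/
def frobeniusNorm {n : ℕ} (X : Matrix (Fin n) (Fin n) ℝ) : ℝ := ‖X‖

end

/-- `𝒜*(y) = ∑ᵢ yᵢ aᵢ aᵢᵀ`, the adjoint of `𝒜(X) = (tr (aᵢ aᵢᵀ X))ᵢ`. -/
def adjointMap {n m : ℕ} (a : Fin m → EuclideanSpace ℝ (Fin n)) (y : Fin m → ℝ) :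
    Matrix (Fin n) (Fin n) ℝ :=
  ∑ i, y i • Matrix.vecMulVec (a i) (a i)

/-- `‖Y_{T^⊥} + 1.7 I_{T^⊥}‖ ≤ 1/10` in the spectral norm and `‖Y_T‖_F ≤ 3/20`. -/
def IsCertificate {n : ℕ} (x₀ : EuclideanSpace ℝ (Fin n)) (Y : Matrix (Fin n) (Fin n) ℝ) : Prop :=
  spectralNorm (frobProj (tangentPerp x₀) Y + (17 / 10 : ℝ) • frobProj (tangentPerp x₀) 1)
      ≤ 1 / 10 ∧
    frobeniusNorm (frobProj (tangentSpace x₀) Y) ≤ 3 / 20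

/-- `β₀ = 𝔼 z⁴ 1(|z| ≤ 3)` for a standard normal variable `z`. -/
def beta0 : ℝ := ∫ z, {z : ℝ | |z| ≤ 3}.indicator (fun z => z ^ 4) z ∂(gaussianReal 0 1)

/-- The coefficients `λᵢ = (⟨aᵢ, x₀⟩² 1(|⟨aᵢ, x₀⟩| ≤ 3) - β₀) / m`. -/
def truncCoeff {n m : ℕ} (a : Fin m → EuclideanSpace ℝ (Fin n)) (x₀ : EuclideanSpace ℝ (Fin n)) :
    Fin m → ℝ :=
  fun i => (1 / (m : ℝ)) * ({z : ℝ | |z| ≤ 3}.indicator (fun z => z ^ 2) (inner ℝ (a i) x₀) - beta0)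

end PhaseLift

end

/-! For a unit vector `x₀`, `Y` is an empirical mean of copies of `f(⟨a, x₀⟩) a aᵀ` with `f(z) = z²
1(|z| ≤ 3) - β₀`. Splitting `a` along `x₀` and its complement into independent Gaussians gives the
mean `𝔼[f z²] x₀x₀ᵀ + 𝔼[f] P`, where `P = 1 - x₀x₀ᵀ`. The choice of `β₀` kills the first term, and
`𝔼[f] = α₀ - β₀` lies within `1/20` of `-17/10` (`abs_beta0_sub_alpha0_sub_le`).

`Y` is close to its mean in spectral norm (`exists_spectralNorm_concentration`): at a fixed unit
vector the quadratic form averages independent variables dominated by squared Gaussians, so Chernoff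
gives failure `2 e^{-κm}`; a union bound over a net of at most `5^n` points is affordable once `m ≥
cn`.

Hence `‖Y + 1.7 P‖ ≤ 1/10`, which yields both inequalities deterministically
(`isCertificate_of_spectralNorm_le`). A general nonzero `x₀` is normalised, since `T` depends only
on its line; for `x₀ = 0` constant coefficients suffice. -/

namespace PhaseLift

/-! ### Nets of the sphere and operator norms -/

section Net

/-- A maximal `1/2`-separated subset of the sphere is a net. Doubling it gives a `1`-separated set
in the ball of radius `2`, where the Besicovitch volume bound `5 ^ dim` applies. If no net existed,
separated sets could be enlarged past that bound. -/
theorem exists_sphere_net (E : Type*) [NormedAddCommGroup E] [NormedSpace ℝ E]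
    [FiniteDimensional ℝ E] :
    ∃ N : Finset E, N.card ≤ 5 ^ Module.finrank ℝ E ∧ (∀ u ∈ N, ‖u‖ = 1) ∧
      ∀ v : E, ‖v‖ = 1 → ∃ u ∈ N, ‖v - u‖ ≤ 1 / 2 := by
  classical
  have hcard : ∀ s : Finset E, (∀ u ∈ s, ‖u‖ = 1) →
      (∀ u ∈ s, ∀ v ∈ s, u ≠ v → 1 / 2 ≤ ‖u - v‖) → s.card ≤ 5 ^ Module.finrank ℝ E := by
    intro s h1 h2
    have hinj : Function.Injective (fun u : E => (2 : ℝ) • u) :=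
      smul_right_injective E two_ne_zero
    rw [← Finset.card_image_of_injective s hinj]
    refine Besicovitch.card_le_of_separated _ ?_ ?_
    · simp only [Finset.mem_image]
      rintro _ ⟨u, hu, rfl⟩
      simp [norm_smul, h1 u hu]
    · simp only [Finset.mem_image]
      rintro _ ⟨u, hu, rfl⟩ _ ⟨v, hv, rfl⟩ huv
      have := h2 u hu v hv (fun h => huv (by rw [h]))
      rw [← smul_sub, norm_smul, Real.norm_two]
      linarith
  by_contra! hcon
  have hext : ∀ k : ℕ, ∃ s : Finset E, s.card = k ∧ (∀ u ∈ s, ‖u‖ = 1) ∧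
      ∀ u ∈ s, ∀ v ∈ s, u ≠ v → 1 / 2 ≤ ‖u - v‖ := by
    intro k
    induction k with
    | zero => exact ⟨∅, by simp⟩
    | succ k ih =>
      obtain ⟨s, hs, h1, h2⟩ := ih
      obtain ⟨v, hv, hvs⟩ := hcon s (hcard s h1 h2) h1
      have hmem : v ∉ s := fun h => by
        have := hvs v h
        norm_num at this
      refine ⟨insert v s, by rw [Finset.card_insert_of_notMem hmem, hs], ?_, ?_⟩
      · intro u hu
        rcases Finset.mem_insert.1 hu with rfl | hu
        exacts [hv, h1 u hu]
      · intro u hu w hw huw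
        rcases Finset.mem_insert.1 hu with rfl | hus <;>
          rcases Finset.mem_insert.1 hw with rfl | hws
        · exact absurd rfl huw
        · exact (hvs w hws).le
        · rw [norm_sub_rev]; exact (hvs u hus).le
        · exact h2 u hus w hws huw
  obtain ⟨s, hs, h1, h2⟩ := hext (5 ^ Module.finrank ℝ E + 1)
  have := hcard s h1 h2
  omega

open scoped RealInnerProductSpace

/-- By symmetry, `⟪v, T v⟫ - ⟪u, T u⟫ = ⟪v - u, T (v + u)⟫`. With a `1/2`-net the triangle
inequality only bounds `‖v - u‖ ‖v + u‖` by `1`, which is useless; the parallelogram law gives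
`√15/4 < 31/32`, and `32 = 1/(1 - 31/32)`. -/
theorem opNorm_le_of_sphere_net {E : Type*} [NormedAddCommGroup E] [InnerProductSpace ℝ E]
    {T : E →L[ℝ] E} (hT : (T : E →ₗ[ℝ] E).IsSymmetric) {N : Finset E} (hN : ∀ u ∈ N, ‖u‖ = 1)
    (hnet : ∀ v : E, ‖v‖ = 1 → ∃ u ∈ N, ‖v - u‖ ≤ 1 / 2) {D : ℝ} (hD : 0 ≤ D)
    (h : ∀ u ∈ N, |⟪u, T u⟫| ≤ D) : ‖T‖ ≤ 32 * D := by
  have key : ∀ v : E, ‖v‖ = 1 → |⟪v, T v⟫| ≤ D + 31 / 32 * ‖T‖ := by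
    intro v hv
    obtain ⟨u, hu, huv⟩ := hnet v hv
    have hu1 := hN u hu
    have hsym : ⟪v, T u⟫ = ⟪u, T v⟫ := by
      rw [real_inner_comm]; exact hT u v
    have e : ⟪v, T v⟫ = ⟪u, T u⟫ + ⟪v - u, T (v + u)⟫ := by
      simp only [map_add, inner_add_right, inner_sub_left]
      rw [hsym]; ring
    have hpar := parallelogram_law_with_norm ℝ v u
    rw [hv, hu1] at hpar
    have hprod : ‖v - u‖ * ‖v + u‖ ≤ 31 / 32 := by
      apply le_of_sq_le_sq _ (by norm_num)
      have h1 : ‖v - u‖ ^ 2 ≤ 1 / 4 := by nlinarith [norm_nonneg (v - u)]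
      nlinarith [norm_nonneg (v - u), norm_nonneg (v + u)]
    calc |⟪v, T v⟫| ≤ |⟪u, T u⟫| + |⟪v - u, T (v + u)⟫| := by rw [e]; exact abs_add_le _ _
      _ ≤ D + ‖v - u‖ * (‖T‖ * ‖v + u‖) := by
        gcongr
        · exact h u hu
        · exact (abs_real_inner_le_norm _ _).trans (by gcongr; exact T.le_opNorm _)
      _ = D + (‖v - u‖ * ‖v + u‖) * ‖T‖ := by ring
      _ ≤ _ := by gcongr
  have hle : ‖T‖ ≤ D + 31 / 32 * ‖T‖ := by
    conv_lhs => rw [T.norm_eq_iSup_rayleighQuotient hT]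
    refine ciSup_le fun x => ?_
    rcases eq_or_ne x 0 with rfl | hx
    · simp; positivity
    · have hx' : ‖x‖ ≠ 0 := norm_ne_zero_iff.2 hx
      rw [← T.rayleigh_smul x (inv_ne_zero hx')]
      have h1 : ‖‖x‖⁻¹ • x‖ = 1 := norm_smul_inv_norm hx
      have := key _ h1
      rw [ContinuousLinearMap.rayleighQuotient]
      simp only [ContinuousLinearMap.reApplyInnerSelf_apply] at *
      rw [h1, one_pow, div_one, real_inner_comm]
      simpa using this
  linarith

end Net

/-! ### Projections onto the tangent space and the deterministic criterion -/

section LinearAlgebra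

open scoped RealInnerProductSpace

variable {n : ℕ}

theorem inner_vecEquiv (A B : Matrix (Fin n) (Fin n) ℝ) :
    ⟪vecEquiv n A, vecEquiv n B⟫ = (A.transpose * B).trace := by
  have h : ∀ (X : Matrix (Fin n) (Fin n) ℝ) p, vecEquiv n X p = X p.1 p.2 := fun _ _ => rfl
  simp only [PiLp.inner_apply, h, Matrix.trace, Matrix.mul_apply, Fintype.sum_prod_type,
    Matrix.diag_apply, Matrix.transpose_apply]
  rw [Finset.sum_comm]
  simp [mul_comm]

theorem frobProj_eq_of_mem {S : Submodule ℝ (Matrix (Fin n) (Fin n) ℝ)}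
    {X V : Matrix (Fin n) (Fin n) ℝ} (hV : V ∈ S)
    (h : ∀ W ∈ S, (W.transpose * (X - V)).trace = 0) : frobProj S X = V := by
  rw [frobProj, LinearEquiv.symm_apply_eq]
  refine (Submodule.eq_starProjection_of_mem_orthogonal (Submodule.mem_map_of_mem hV) ?_)
  rw [Submodule.mem_orthogonal]
  rintro _ ⟨W, hW, rfl⟩
  have := h W hW
  rw [← inner_vecEquiv] at this
  simpa using this

theorem tangentSpace_smul (x₀ : EuclideanSpace ℝ (Fin n)) {r : ℝ} (hr : r ≠ 0) :
    tangentSpace (r • x₀) = tangentSpace x₀ := by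
  ext X
  constructor
  · rintro ⟨x, rfl⟩
    exact ⟨r • x, by ext i j; simp [Matrix.vecMulVec_apply]⟩
  · rintro ⟨x, rfl⟩
    exact ⟨r⁻¹ • x, by ext i j; simp [Matrix.vecMulVec_apply]; field_simp⟩

theorem isCertificate_smul_iff (x₀ : EuclideanSpace ℝ (Fin n)) {r : ℝ} (hr : r ≠ 0)
    (Y : Matrix (Fin n) (Fin n) ℝ) : IsCertificate (r • x₀) Y ↔ IsCertificate x₀ Y := by
  have h : tangentPerp (r • x₀) = tangentPerp x₀ := by
    ext X
    simp only [tangentPerp, Submodule.mem_mk, tangentSpace_smul x₀ hr]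
  rw [IsCertificate, IsCertificate, h, tangentSpace_smul x₀ hr]


theorem trace_mul_eq_zero_of_mem_tangentPerp {x₀ : EuclideanSpace ℝ (Fin n)}
    {U V : Matrix (Fin n) (Fin n) ℝ} (hU : U ∈ tangentPerp x₀) (hV : V ∈ tangentSpace x₀) :
    (U.transpose * V).trace = 0 := by
  rw [← Matrix.trace_transpose, Matrix.transpose_mul, Matrix.transpose_transpose]
  exact hU.2 V hV

/-- For symmetric `X`, the pairing of `X` with `y x₀ᵀ + x₀ yᵀ` is `2 y · X x₀`. -/
theorem mem_tangentPerp_of_mulVec_eq_zero {x₀ : EuclideanSpace ℝ (Fin n)}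
    {X : Matrix (Fin n) (Fin n) ℝ} (hX : X.IsSymm) (h : X.mulVec x₀ = 0) :
    X ∈ tangentPerp x₀ := by
  refine ⟨hX, ?_⟩
  rintro _ ⟨y, rfl⟩
  have h' : Matrix.vecMul x₀ X = 0 := by rw [← Matrix.mulVec_transpose, hX.eq, h]
  rw [Matrix.transpose_add, Matrix.transpose_vecMulVec, Matrix.transpose_vecMulVec,
    Matrix.add_mul, Matrix.vecMulVec_mul, Matrix.vecMulVec_mul, h', Matrix.trace_add,
    Matrix.trace_vecMulVec, Matrix.trace_vecMulVec, dotProduct_comm, ← Matrix.dotProduct_mulVec, h]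
  simp

/-- The vector `x` for which `x x₀ᵀ + x₀ xᵀ` is the tangential part of `Y`, for a unit
vector `x₀`. -/
noncomputable def tangentVec (Y : Matrix (Fin n) (Fin n) ℝ) (p : Fin n → ℝ) : Fin n → ℝ :=
  Y.mulVec p - ((p ⬝ᵥ Y.mulVec p) / 2) • p

/-- The correction by half of `p · Y p` in `tangentVec` compensates for the `x₀x₀ᵀ` component being
counted twice, so the residual annihilates `x₀`. -/
theorem sub_tangent_mem_tangentPerp {x₀ : EuclideanSpace ℝ (Fin n)} (h₀ : x₀.ofLp ⬝ᵥ x₀.ofLp = 1)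
    {Y : Matrix (Fin n) (Fin n) ℝ} (hY : Y.IsSymm) :
    Y - (Matrix.vecMulVec (tangentVec Y x₀) x₀ + Matrix.vecMulVec x₀ (tangentVec Y x₀)) ∈
      tangentPerp x₀ := by
  refine mem_tangentPerp_of_mulVec_eq_zero ?_ ?_
  · rw [Matrix.IsSymm, Matrix.transpose_sub, hY.eq, Matrix.transpose_add,
      Matrix.transpose_vecMulVec, Matrix.transpose_vecMulVec, add_comm]
  · rw [Matrix.sub_mulVec, Matrix.add_mulVec, Matrix.vecMulVec_mulVec, Matrix.vecMulVec_mulVec, h₀]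
    have : tangentVec Y x₀ ⬝ᵥ x₀.ofLp = (x₀.ofLp ⬝ᵥ Y.mulVec x₀) / 2 := by
      rw [tangentVec, sub_dotProduct, smul_dotProduct, h₀, dotProduct_comm]
      simp; ring
    rw [this, tangentVec]
    ext i
    simp
    ring

theorem tangent_mem_tangentSpace (x₀ : EuclideanSpace ℝ (Fin n)) (x : Fin n → ℝ) :
    Matrix.vecMulVec x x₀ + Matrix.vecMulVec x₀ x ∈ tangentSpace x₀ :=
  ⟨WithLp.toLp 2 x, rfl⟩

theorem frobProj_tangentPerp {x₀ : EuclideanSpace ℝ (Fin n)} (h₀ : x₀.ofLp ⬝ᵥ x₀.ofLp = 1)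
    {Y : Matrix (Fin n) (Fin n) ℝ} (hY : Y.IsSymm) :
    frobProj (tangentPerp x₀) Y =
      Y - (Matrix.vecMulVec (tangentVec Y x₀) x₀ + Matrix.vecMulVec x₀ (tangentVec Y x₀)) := by
  refine frobProj_eq_of_mem (sub_tangent_mem_tangentPerp h₀ hY) fun W hW => ?_
  rw [sub_sub_cancel]
  exact trace_mul_eq_zero_of_mem_tangentPerp hW (tangent_mem_tangentSpace _ _)

theorem frobProj_tangentSpace {x₀ : EuclideanSpace ℝ (Fin n)} (h₀ : x₀.ofLp ⬝ᵥ x₀.ofLp = 1)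
    {Y : Matrix (Fin n) (Fin n) ℝ} (hY : Y.IsSymm) :
    frobProj (tangentSpace x₀) Y =
      Matrix.vecMulVec (tangentVec Y x₀) x₀ + Matrix.vecMulVec x₀ (tangentVec Y x₀) :=
  frobProj_eq_of_mem (tangent_mem_tangentSpace _ _)
    (sub_tangent_mem_tangentPerp h₀ hY).2

theorem frobProj_tangentPerp_one {x₀ : EuclideanSpace ℝ (Fin n)}
    (h₀ : x₀.ofLp ⬝ᵥ x₀.ofLp = 1) :
    frobProj (tangentPerp x₀) 1 = 1 - Matrix.vecMulVec x₀.ofLp x₀.ofLp := by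
  rw [frobProj_tangentPerp h₀ Matrix.isSymm_one, tangentVec]
  ext i j
  simp [h₀, Matrix.vecMulVec_apply]
  ring

theorem frobeniusNorm_sq (A : Matrix (Fin n) (Fin n) ℝ) :
    frobeniusNorm A ^ 2 = ∑ i, ∑ j, A i j ^ 2 := by
  rw [frobeniusNorm, Matrix.frobenius_norm_def, ← Real.sqrt_eq_rpow, Real.sq_sqrt (by positivity)]
  simp

theorem frobeniusNorm_tangent_sq (x p : Fin n → ℝ) :
    frobeniusNorm (Matrix.vecMulVec x p + Matrix.vecMulVec p x) ^ 2 =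
      2 * (x ⬝ᵥ x) * (p ⬝ᵥ p) + 2 * (x ⬝ᵥ p) ^ 2 := by
  have e : ∀ i j, (Matrix.vecMulVec x p + Matrix.vecMulVec p x) i j ^ 2 =
      (x i * x i) * (p j * p j) + (p i * p i) * (x j * x j) + 2 * ((x i * p i) * (x j * p j)) := by
    intro i j
    simp only [Matrix.add_apply, Matrix.vecMulVec_apply]
    ring
  simp_rw [frobeniusNorm_sq, e, Finset.sum_add_distrib, ← Finset.mul_sum, ← Finset.sum_mul]
  simp only [dotProduct]
  ring

theorem one_sub_vecMulVec_mul_self {p : Fin n → ℝ} (hp : p ⬝ᵥ p = 1) :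
    ((1 : Matrix (Fin n) (Fin n) ℝ) - Matrix.vecMulVec p p) * (1 - Matrix.vecMulVec p p) =
      1 - Matrix.vecMulVec p p := by
  have h : Matrix.vecMulVec p p * Matrix.vecMulVec p p = Matrix.vecMulVec p p := by
    rw [Matrix.vecMulVec_mul_vecMulVec, hp]; simp
  rw [mul_sub, sub_mul, sub_mul, h]
  simp

-- The C*-identity for a self-adjoint idempotent reads `‖P‖² = ‖P‖`.
open scoped Matrix.Norms.L2Operator in
theorem norm_one_sub_vecMulVec_le {p : Fin n → ℝ} (hp : p ⬝ᵥ p = 1) :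
    ‖(1 : Matrix (Fin n) (Fin n) ℝ) - Matrix.vecMulVec p p‖ ≤ 1 := by
  set P := (1 : Matrix (Fin n) (Fin n) ℝ) - Matrix.vecMulVec p p with hP
  have hH : P.conjTranspose = P := by
    rw [hP, Matrix.conjTranspose_eq_transpose_of_trivial, Matrix.transpose_sub,
      Matrix.transpose_vecMulVec, Matrix.transpose_one]
  have hPP : P * P = P :=
    one_sub_vecMulVec_mul_self hp
  have := Matrix.l2_opNorm_conjTranspose_mul_self P
  rw [hH, hPP] at this
  nlinarith [norm_nonneg P]

theorem dotProduct_self_eq_one {v : EuclideanSpace ℝ (Fin n)} (hv : ‖v‖ = 1) :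
    v.ofLp ⬝ᵥ v.ofLp = 1 := by
  have := EuclideanSpace.real_norm_sq_eq v
  rw [hv] at this
  simpa [dotProduct, sq] using this.symm

/-- The projection onto `T^⊥` is compression by `P`, a contraction. The tangential part depends only
on `Y x₀`, which equals `M x₀` because `P x₀ = 0`, and so has norm at most `1/10`. -/
theorem isCertificate_of_spectralNorm_le {x₀ : EuclideanSpace ℝ (Fin n)} (hx₀ : ‖x₀‖ = 1)
    {Y : Matrix (Fin n) (Fin n) ℝ} (hY : Y.IsSymm)
    (hM : spectralNorm (Y + (17 / 10 : ℝ) • (1 - Matrix.vecMulVec x₀.ofLp x₀.ofLp)) ≤ 1 / 10) :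
    IsCertificate x₀ Y := by
  have h₀ : x₀.ofLp ⬝ᵥ x₀.ofLp = 1 := dotProduct_self_eq_one hx₀
  set p := x₀.ofLp with hp
  set P := (1 : Matrix (Fin n) (Fin n) ℝ) - Matrix.vecMulVec p p with hP
  set M := Y + (17 / 10 : ℝ) • P with hMdef
  have hpY : Matrix.vecMul p Y = Y.mulVec p := by rw [← Matrix.mulVec_transpose, hY.eq]
  have hPp : P.mulVec p = 0 := by
    rw [hP, Matrix.sub_mulVec, Matrix.vecMulVec_mulVec, h₀]; simp
  constructor
  · rw [frobProj_tangentPerp h₀ hY, frobProj_tangentPerp_one h₀, ← hP]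
    have hPP : P * P = P := one_sub_vecMulVec_mul_self h₀
    have e : Y - (Matrix.vecMulVec (tangentVec Y p) p + Matrix.vecMulVec p (tangentVec Y p)) +
        (17 / 10 : ℝ) • P = P * M * P := by
      have hPYP : P * Y * P = Y - (Matrix.vecMulVec (tangentVec Y p) p +
          Matrix.vecMulVec p (tangentVec Y p)) := by
        rw [hP, Matrix.sub_mul, Matrix.one_mul, Matrix.vecMulVec_mul, Matrix.mul_sub,
          Matrix.mul_one, Matrix.sub_mul, Matrix.mul_vecMulVec, Matrix.vecMulVec_mul_vecMulVec,
          hpY, tangentVec]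
        ext i j
        simp [Matrix.vecMulVec_apply]
        rw [dotProduct_comm]
        ring
      rw [hMdef, Matrix.mul_add, Matrix.add_mul, hPYP, Matrix.mul_smul, Matrix.smul_mul, hPP, hPP]
    rw [e]
    refine le_trans ?_ hM
    rw [spectralNorm, spectralNorm]
    open scoped Matrix.Norms.L2Operator in
    calc ‖P * M * P‖ ≤ ‖P‖ * ‖M‖ * ‖P‖ := (norm_mul_le _ _).trans (by gcongr; exact norm_mul_le _ _)
      _ ≤ 1 * ‖M‖ * 1 := by gcongr <;> exact norm_one_sub_vecMulVec_le h₀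
      _ = ‖M‖ := by ring
  · rw [frobProj_tangentSpace h₀ hY]
    have hYp : M.mulVec p = Y.mulVec p := by
      rw [hMdef, Matrix.add_mulVec, Matrix.smul_mulVec, hPp]; simp
    have hnorm : Y.mulVec p ⬝ᵥ Y.mulVec p ≤ (1 / 10) ^ 2 := by
      have := Matrix.l2_opNorm_mulVec M x₀
      rw [hx₀, mul_one, ← hp, hYp] at this
      have h2 := pow_le_pow_left₀ (norm_nonneg _) (this.trans hM) 2
      rw [EuclideanSpace.real_norm_sq_eq] at h2
      simpa [dotProduct, sq] using h2
    refine le_of_sq_le_sq ?_ (by norm_num)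
    rw [frobeniusNorm_tangent_sq, h₀]
    have e1 : tangentVec Y p ⬝ᵥ p = (p ⬝ᵥ Y.mulVec p) / 2 := by
      rw [tangentVec, sub_dotProduct, smul_dotProduct, h₀, dotProduct_comm]
      simp; ring
    have e2 : tangentVec Y p ⬝ᵥ tangentVec Y p =
        Y.mulVec p ⬝ᵥ Y.mulVec p - 3 / 4 * (p ⬝ᵥ Y.mulVec p) ^ 2 := by
      simp only [tangentVec, sub_dotProduct, smul_dotProduct, h₀, dotProduct_sub, dotProduct_smul,
        smul_eq_mul]
      rw [dotProduct_comm (Y.mulVec p) p]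
      ring
    rw [e1, e2]
    -- The left side equals `2‖Yp‖² - (p · Yp)²`, at most `1/50 < (3/20)²`.
    nlinarith [sq_nonneg (p ⬝ᵥ Y.mulVec p)]

theorem isCertificate_zero_of_spectralNorm_le {Y : Matrix (Fin n) (Fin n) ℝ} (hY : Y.IsSymm)
    (hM : spectralNorm (Y + (17 / 10 : ℝ) • 1) ≤ 1 / 10) : IsCertificate 0 Y := by
  have hperp : ∀ X : Matrix (Fin n) (Fin n) ℝ, X.IsSymm → frobProj (tangentPerp 0) X = X :=
    fun X hX => frobProj_eq_of_mem (mem_tangentPerp_of_mulVec_eq_zero hX (by simp)) (by simp)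
  have htan : frobProj (tangentSpace 0) Y = 0 := by
    refine frobProj_eq_of_mem (zero_mem _) ?_
    rintro _ ⟨y, rfl⟩
    simp
  refine ⟨?_, ?_⟩
  · rwa [hperp Y hY, hperp 1 Matrix.isSymm_one]
  · rw [htan]
    have h : frobeniusNorm (0 : Matrix (Fin n) (Fin n) ℝ) = 0 := by
      simpa using frobeniusNorm_sq (0 : Matrix (Fin n) (Fin n) ℝ)
    rw [h]
    norm_num

theorem adjointMap_isSymm {m : ℕ} (a : Fin m → EuclideanSpace ℝ (Fin n)) (y : Fin m → ℝ) :
    (adjointMap a y).IsSymm := by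
  rw [adjointMap, Matrix.IsSymm, Matrix.transpose_sum]
  simp [Matrix.transpose_vecMulVec]

theorem dotProduct_adjointMap_mulVec {m : ℕ} (a : Fin m → EuclideanSpace ℝ (Fin n))
    (y : Fin m → ℝ) (v : EuclideanSpace ℝ (Fin n)) :
    v.ofLp ⬝ᵥ (adjointMap a y).mulVec v = ∑ i, y i * ⟪a i, v⟫ ^ 2 := by
  rw [adjointMap, Matrix.sum_mulVec, dotProduct_sum]
  refine Finset.sum_congr rfl fun i _ => ?_
  rw [Matrix.smul_mulVec, Matrix.vecMulVec_mulVec, dotProduct_smul]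
  have h : ⟪a i, v⟫ = v.ofLp ⬝ᵥ (a i).ofLp := by simp [PiLp.inner_apply, dotProduct]
  rw [h, dotProduct_comm (a i).ofLp]
  simp [sq]

theorem spectralNorm_le_of_sphere_net {M : Matrix (Fin n) (Fin n) ℝ} (hM : M.IsSymm)
    {N : Finset (EuclideanSpace ℝ (Fin n))} (hN : ∀ u ∈ N, ‖u‖ = 1)
    (hnet : ∀ v : EuclideanSpace ℝ (Fin n), ‖v‖ = 1 → ∃ u ∈ N, ‖v - u‖ ≤ 1 / 2) {D : ℝ}
    (hD : 0 ≤ D) (h : ∀ u ∈ N, |u.ofLp ⬝ᵥ M.mulVec u| ≤ D) : spectralNorm M ≤ 32 * D := by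
  rw [spectralNorm, ← Matrix.l2_opNorm_toEuclideanCLM]
  refine opNorm_le_of_sphere_net ?_ hN hnet hD ?_
  · rw [Matrix.coe_toEuclideanCLM_eq_toEuclideanLin, Matrix.isSymmetric_toEuclideanLin_iff,
      Matrix.IsHermitian, Matrix.conjTranspose_eq_transpose_of_trivial, hM.eq]
  · intro u hu
    rw [Matrix.inner_toEuclideanCLM]
    exact h u hu

end LinearAlgebra

/-! ### Chernoff bounds for variables dominated by squared Gaussians -/

section Concentration

theorem exp_le_one_add_add_sq_mul_exp_abs (x : ℝ) :
    Real.exp x ≤ 1 + x + x ^ 2 * Real.exp |x| := by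
  have h := Complex.norm_exp_sub_sum_le_norm_mul_exp (x : ℂ) 2
  have e : Complex.exp x - ∑ k ∈ Finset.range 2, (x : ℂ) ^ k / (k.factorial : ℂ) =
      ((Real.exp x - (1 + x) : ℝ) : ℂ) := by
    simp [Finset.sum_range_succ]
  rw [e, Complex.norm_real, Complex.norm_real, Real.norm_eq_abs, Real.norm_eq_abs, sq_abs] at h
  linarith [le_abs_self (Real.exp x - (1 + x))]

/-- Fernique's theorem makes `exp (C W²)` integrable for some `C > 0`. For `|t| ≤ C/(2B)` the
remainder of `exp (tX)` beyond first order is at most `(tX)² exp (C W²/2)`; the other half of the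
exponent absorbs `W⁴`. The constants depend on `B` alone. -/
theorem exists_mgf_le_of_abs_le_sq {B : ℝ} (hB : 0 < B) :
    ∃ K : ℝ, 0 < K ∧ ∃ t₀ : ℝ, 0 < t₀ ∧ ∀ {Ω : Type*} [MeasurableSpace Ω] (P : Measure Ω)
      [IsProbabilityMeasure P] (X W : Ω → ℝ), AEMeasurable X P → HasLaw W (gaussianReal 0 1) P →
      (∀ ω, |X ω| ≤ B * W ω ^ 2) → ∀ t : ℝ, |t| ≤ t₀ →
      Integrable X P ∧ Integrable (fun ω => Real.exp (t * X ω)) P ∧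
        mgf X P t ≤ Real.exp (t * ∫ ω, X ω ∂P + K * t ^ 2) := by
  obtain ⟨C, hC, hint⟩ := IsGaussian.exists_integrable_exp_sq (gaussianReal 0 1)
  simp only [Real.norm_eq_abs, sq_abs] at hint
  set J := ∫ w, Real.exp (C * w ^ 2) ∂(gaussianReal 0 1) with hJ
  have hJpos : 0 < J := integral_exp_pos hint
  refine ⟨8 * B ^ 2 / C ^ 2 * J, by positivity, C / (2 * B), by positivity, ?_⟩
  intro Ω _ P _ X W hX hW hXW t ht
  have hWint : Integrable (fun ω => Real.exp (C * W ω ^ 2)) P := by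
    rw [← hW.map_eq] at hint
    exact hint.comp_aemeasurable hW.aemeasurable
  have hWJ : ∫ ω, Real.exp (C * W ω ^ 2) ∂P = J :=
    hW.integral_comp (f := fun w => Real.exp (C * w ^ 2)) (by fun_prop)
  have htX : ∀ ω, |t * X ω| ≤ C * W ω ^ 2 / 2 := fun ω => by
    rw [abs_mul]
    calc |t| * |X ω| ≤ C / (2 * B) * (B * W ω ^ 2) := by gcongr; exact hXW ω
      _ = _ := by field_simp
  have hquad : ∀ ω, (W ω ^ 2) ^ 2 ≤ 8 / C ^ 2 * Real.exp (C * W ω ^ 2 / 2) := fun ω => by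
    have := Real.quadratic_le_exp_of_nonneg (x := C * W ω ^ 2 / 2) (by positivity)
    have h2 : C ^ 2 * (W ω ^ 2) ^ 2 / 8 ≤ Real.exp (C * W ω ^ 2 / 2) := by
      nlinarith [show 0 ≤ C * W ω ^ 2 by positivity]
    rw [div_mul_eq_mul_div, le_div_iff₀ (by positivity)]
    linarith
  have hXint : Integrable X P := by
    refine (hWint.const_mul (B / C)).mono' hX.aestronglyMeasurable (ae_of_all _ fun ω => ?_)
    rw [Real.norm_eq_abs]
    refine (hXW ω).trans ?_
    have := Real.add_one_le_exp (C * W ω ^ 2)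
    calc B * W ω ^ 2 = B / C * (C * W ω ^ 2) := by field_simp
      _ ≤ _ := by gcongr; linarith
  have hexp : Integrable (fun ω => Real.exp (t * X ω)) P := by
    refine hWint.mono' (by fun_prop) (ae_of_all _ fun ω => ?_)
    rw [Real.norm_eq_abs, Real.abs_exp, Real.exp_le_exp]
    have : 0 ≤ C * W ω ^ 2 := by positivity
    linarith [le_abs_self (t * X ω), htX ω]
  refine ⟨hXint, hexp, ?_⟩
  have hpt : ∀ ω, Real.exp (t * X ω) ≤
      1 + t * X ω + t ^ 2 * (8 * B ^ 2 / C ^ 2) * Real.exp (C * W ω ^ 2) := fun ω => by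
    refine (exp_le_one_add_add_sq_mul_exp_abs _).trans ?_
    gcongr 1 + t * X ω + ?_
    have h1 : (X ω) ^ 2 ≤ (B * W ω ^ 2) ^ 2 := by
      rw [← sq_abs]; gcongr; exact hXW ω
    calc (t * X ω) ^ 2 * Real.exp |t * X ω|
        = t ^ 2 * (X ω) ^ 2 * Real.exp |t * X ω| := by ring
      _ ≤ t ^ 2 * (B * W ω ^ 2) ^ 2 * Real.exp (C * W ω ^ 2 / 2) := by
        gcongr; exact htX ω
      _ = t ^ 2 * B ^ 2 * (W ω ^ 2) ^ 2 * Real.exp (C * W ω ^ 2 / 2) := by ring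
      _ ≤ t ^ 2 * B ^ 2 * (8 / C ^ 2 * Real.exp (C * W ω ^ 2 / 2)) *
          Real.exp (C * W ω ^ 2 / 2) := by gcongr; exact hquad ω
      _ = t ^ 2 * (8 * B ^ 2 / C ^ 2) *
          (Real.exp (C * W ω ^ 2 / 2) * Real.exp (C * W ω ^ 2 / 2)) := by ring
      _ = _ := by rw [← Real.exp_add, add_halves]
  have hi1 : Integrable (fun ω => 1 + t * X ω) P := (integrable_const _).add (hXint.const_mul t)
  have hi2 := hWint.const_mul (t ^ 2 * (8 * B ^ 2 / C ^ 2))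
  calc mgf X P t ≤ ∫ ω, (1 + t * X ω +
          t ^ 2 * (8 * B ^ 2 / C ^ 2) * Real.exp (C * W ω ^ 2)) ∂P :=
        integral_mono hexp (hi1.add hi2) hpt
    _ = t * ∫ ω, X ω ∂P + 8 * B ^ 2 / C ^ 2 * J * t ^ 2 + 1 := by
        rw [integral_add hi1 hi2, integral_add (integrable_const _) (hXint.const_mul t),
          integral_const_mul, integral_const_mul, hWJ]
        simp
        ring
    _ ≤ _ := Real.add_one_le_exp _

theorem exists_sum_upper_tail_le {B δ : ℝ} (hB : 0 < B) (hδ : 0 < δ) :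
    ∃ κ : ℝ, 0 < κ ∧ ∀ {Ω : Type*} [MeasurableSpace Ω] (P : Measure Ω) [IsProbabilityMeasure P]
      (m : ℕ) (X W : Fin m → Ω → ℝ) (μ : ℝ), iIndepFun X P → (∀ i, AEMeasurable (X i) P) →
      (∀ i, HasLaw (W i) (gaussianReal 0 1) P) → (∀ i ω, |X i ω| ≤ B * W i ω ^ 2) →
      (∀ i, ∫ ω, X i ω ∂P = μ) →
      P.real {ω | m * (μ + δ) ≤ ∑ i, X i ω} ≤ Real.exp (-κ * m) := by
  obtain ⟨K, hK, t₀, ht₀, h⟩ := exists_mgf_le_of_abs_le_sq hB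
  -- This gives `K t ≤ δ/2`, so the Chernoff exponent `m t (K t - δ)` is at most `-(t δ / 2) m`.
  set t := min t₀ (δ / (2 * K)) with ht
  have htpos : 0 < t := by positivity
  refine ⟨t * δ / 2, by positivity, ?_⟩
  intro Ω _ P _ m X W μ hind hmeas hW hXW hμ
  have hi := fun i => h P (X i) (W i) (hmeas i) (hW i) (hXW i) t
    (by rw [abs_of_pos htpos]; exact min_le_left _ _)
  have hint : Integrable (fun ω => Real.exp (t * (∑ i, X i) ω)) P := by
    -- A non-integrable exponential has integral `0` by convention, whereas the mgf factors by
    -- independence into positive terms.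
    by_contra hcon
    have h0 : mgf (∑ i, X i) P t = 0 := integral_undef hcon
    rw [hind.mgf_sum₀ hmeas, Finset.prod_eq_zero_iff] at h0
    obtain ⟨i, -, hi0⟩ := h0
    exact (mgf_pos (hi i).2.1).ne' hi0
  have hch := measure_ge_le_exp_mul_mgf (μ := P) (X := ∑ i, X i) (m * (μ + δ)) htpos.le hint
  simp only [Finset.sum_apply] at hch
  refine hch.trans ?_
  rw [hind.mgf_sum₀ hmeas]
  have hprod : ∏ i, mgf (X i) P t ≤ Real.exp (t * μ + K * t ^ 2) ^ m := by
    calc ∏ i, mgf (X i) P t ≤ ∏ _i : Fin m, Real.exp (t * μ + K * t ^ 2) := by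
          refine Finset.prod_le_prod (fun i _ => mgf_nonneg) fun i _ => ?_
          have := (hi i).2.2
          rwa [hμ i] at this
      _ = _ := by simp
  calc Real.exp (-t * (m * (μ + δ))) * ∏ i, mgf (X i) P t
      ≤ Real.exp (-t * (m * (μ + δ))) * Real.exp (t * μ + K * t ^ 2) ^ m := by gcongr
    _ = Real.exp (m * (t * (K * t - δ))) := by
        rw [← Real.exp_nat_mul, ← Real.exp_add]; congr 1; ring
    _ ≤ _ := by
        rw [Real.exp_le_exp]
        have h1 : K * t ≤ δ / 2 := by
          calc K * t ≤ K * (δ / (2 * K)) := by gcongr; exact min_le_right _ _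
            _ = δ / 2 := by field_simp
        have h2 : t * (K * t - δ) ≤ t * (-(δ / 2)) := by gcongr; linarith
        have h3 := mul_le_mul_of_nonneg_left h2 (Nat.cast_nonneg (α := ℝ) m)
        linarith

theorem exists_sum_tail_le {B δ : ℝ} (hB : 0 < B) (hδ : 0 < δ) :
    ∃ κ : ℝ, 0 < κ ∧ ∀ {Ω : Type*} [MeasurableSpace Ω] (P : Measure Ω) [IsProbabilityMeasure P]
      (m : ℕ) (X W : Fin m → Ω → ℝ) (μ : ℝ), iIndepFun X P → (∀ i, AEMeasurable (X i) P) →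
      (∀ i, HasLaw (W i) (gaussianReal 0 1) P) → (∀ i ω, |X i ω| ≤ B * W i ω ^ 2) →
      (∀ i, ∫ ω, X i ω ∂P = μ) →
      P.real {ω | m * δ ≤ |∑ i, X i ω - m * μ|} ≤ 2 * Real.exp (-κ * m) := by
  obtain ⟨κ, hκ, h⟩ := exists_sum_upper_tail_le hB hδ
  refine ⟨κ, hκ, ?_⟩
  intro Ω _ P _ m X W μ hind hmeas hW hXW hμ
  have h1 := h P m X W μ hind hmeas hW hXW hμ
  have h2 := h P m (fun i ω => - X i ω) W (-μ)
    (hind.comp (fun _ x => -x) fun _ => measurable_neg) (fun i => (hmeas i).neg) hW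
    (fun i ω => by rw [abs_neg]; exact hXW i ω) (fun i => by rw [integral_neg, hμ i])
  have hsub : {ω | m * δ ≤ |∑ i, X i ω - m * μ|} ⊆
      {ω | m * (μ + δ) ≤ ∑ i, X i ω} ∪ {ω | m * (-μ + δ) ≤ ∑ i, - X i ω} := by
    intro ω hω
    simp only [Set.mem_ofPred_eq, Set.mem_union, Finset.sum_neg_distrib] at *
    rcases le_abs.1 hω with h | h
    · left; linarith
    · right; linarith
  linarith [measureReal_mono hsub (μ := P), measureReal_union_le (μ := P)
    {ω | m * (μ + δ) ≤ ∑ i, X i ω} {ω | m * (-μ + δ) ≤ ∑ i, - X i ω}]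

end Concentration

/-! ### Spectral concentration of weighted Gaussian sample matrices -/

section RandomMatrix

open scoped RealInnerProductSpace

variable {n : ℕ}

theorem hasLaw_inner_stdGaussian {v : EuclideanSpace ℝ (Fin n)} (hv : ‖v‖ = 1) :
    HasLaw (fun x => ⟪x, v⟫) (gaussianReal 0 1) (stdGaussian (EuclideanSpace ℝ (Fin n))) := by
  refine ⟨by fun_prop, ?_⟩
  have h := IsGaussian.map_eq_gaussianReal (μ := stdGaussian (EuclideanSpace ℝ (Fin n)))
    (innerSL ℝ v)
  rw [integral_strongDual_stdGaussian, variance_dual_stdGaussian, innerSL_apply_norm, hv] at h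
  have e : (fun x => ⟪x, v⟫) = innerSL ℝ v := by
    ext x; rw [innerSL_apply_apply, real_inner_comm]
  rw [e, h]
  simp

/-- The weight `F` is arbitrary so that the truncated coefficients and the constant ones used for
`x₀ = 0` share the same `c` and `γ`. -/
theorem exists_spectralNorm_concentration {B η : ℝ} (hB : 0 < B) (hη : 0 < η) :
    ∃ c : ℝ, 0 < c ∧ ∃ γ : ℝ, 0 < γ ∧ ∀ (n m : ℕ), c * (n : ℝ) ≤ m →
      ∀ {Ω : Type*} [MeasurableSpace Ω] (P : Measure Ω) [IsProbabilityMeasure P]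
        (a : Fin m → Ω → EuclideanSpace ℝ (Fin n)),
        (∀ i, HasLaw (a i) (stdGaussian (EuclideanSpace ℝ (Fin n))) P) → iIndepFun a P →
        ∀ (F : EuclideanSpace ℝ (Fin n) → ℝ) (Q : Matrix (Fin n) (Fin n) ℝ), Measurable F →
        (∀ x, |F x| ≤ B) → Q.IsSymm →
        (∀ v : EuclideanSpace ℝ (Fin n), ‖v‖ = 1 →
          ∫ x, F x * ⟪x, v⟫ ^ 2 ∂(stdGaussian (EuclideanSpace ℝ (Fin n))) =
            v.ofLp ⬝ᵥ Q.mulVec v) →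
        P {ω | η < spectralNorm (adjointMap (fun i => a i ω) (fun i => 1 / (m : ℝ) * F (a i ω)) - Q)}
          ≤ ENNReal.ofReal (2 * Real.exp (-γ * m)) := by
  obtain ⟨κ, hκ, htail⟩ := exists_sum_tail_le hB (show 0 < η / 32 by positivity)
  have hlog : 0 < Real.log 5 := Real.log_pos (by norm_num)
  -- With this `c`, `5^n ≤ exp (κ m / 2)`: the net costs half of the exponent.
  refine ⟨2 * Real.log 5 / κ, by positivity, κ / 2, by positivity, ?_⟩
  intro n m hnm Ω _ P _ a ha hind F Q hF hFB hQ hmean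
  rcases Nat.eq_zero_or_pos m with rfl | hm
  -- For `m = 0` the bound is `2`, hence trivial.
  · refine prob_le_one.trans ?_
    simp
  have hm' : (0 : ℝ) < m := by exact_mod_cast hm
  obtain ⟨N, hNcard, hN1, hnet⟩ := exists_sphere_net (EuclideanSpace ℝ (Fin n))
  rw [finrank_euclideanSpace_fin] at hNcard
  set Bad : EuclideanSpace ℝ (Fin n) → Set Ω := fun u =>
    {ω | m * (η / 32) ≤ |∑ i, F (a i ω) * ⟪a i ω, u⟫ ^ 2 - m * (u.ofLp ⬝ᵥ Q.mulVec u)|} with hBad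
  have hsub : {ω | η < spectralNorm
      (adjointMap (fun i => a i ω) (fun i => 1 / (m : ℝ) * F (a i ω)) - Q)} ⊆ ⋃ u ∈ N, Bad u := by
    intro ω hω
    by_contra hcon
    simp only [Set.mem_iUnion, hBad, Set.mem_ofPred_eq, not_exists, not_le] at hcon hω
    refine absurd hω (not_lt.2 ?_)
    have := spectralNorm_le_of_sphere_net (D := η / 32) ((adjointMap_isSymm (fun i => a i ω)
      (fun i => 1 / (m : ℝ) * F (a i ω))).sub hQ) hN1 hnet (by positivity) ?_
    · linarith
    · intro u hu
      have h := hcon u hu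
      rw [Matrix.sub_mulVec, dotProduct_sub, dotProduct_adjointMap_mulVec]
      simp_rw [mul_assoc]
      rw [← Finset.mul_sum]
      set S := ∑ i, F (a i ω) * ⟪a i ω, u⟫ ^ 2
      have e : 1 / (m : ℝ) * S - u.ofLp ⬝ᵥ Q.mulVec u =
          (S - m * (u.ofLp ⬝ᵥ Q.mulVec u)) / m := by field_simp
      rw [e, abs_div, abs_of_pos hm', div_le_iff₀ hm']
      linarith
  have hbad : ∀ u ∈ N, P (Bad u) ≤ ENNReal.ofReal (2 * Real.exp (-κ * m)) := by
    intro u hu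
    have hg : Measurable fun x : EuclideanSpace ℝ (Fin n) => F x * ⟪x, u⟫ ^ 2 := by fun_prop
    have h := htail P m (fun i ω => F (a i ω) * ⟪a i ω, u⟫ ^ 2) (fun i ω => ⟪a i ω, u⟫)
      (u.ofLp ⬝ᵥ Q.mulVec u) (hind.comp (fun _ x => F x * ⟪x, u⟫ ^ 2) fun _ => hg)
      (fun i => hg.comp_aemeasurable (ha i).aemeasurable)
      (fun i => (hasLaw_inner_stdGaussian (hN1 u hu)).fun_comp (ha i))
      (fun i ω => by rw [abs_mul, abs_sq]; gcongr; exact hFB _)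
      (fun i => by
        rw [← hmean u (hN1 u hu)]
        exact (ha i).integral_comp hg.aestronglyMeasurable)
    rw [← ofReal_measureReal]
    exact ENNReal.ofReal_le_ofReal h
  calc _ ≤ P (⋃ u ∈ N, Bad u) := measure_mono hsub
    _ ≤ ∑ u ∈ N, P (Bad u) := measure_biUnion_finset_le _ _
    _ ≤ ∑ _u ∈ N, ENNReal.ofReal (2 * Real.exp (-κ * m)) := Finset.sum_le_sum hbad
    _ = ENNReal.ofReal (N.card * (2 * Real.exp (-κ * m))) := by
      rw [Finset.sum_const, nsmul_eq_mul, ENNReal.ofReal_mul (Nat.cast_nonneg _),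
        ENNReal.ofReal_natCast]
    _ ≤ _ := by
      refine ENNReal.ofReal_le_ofReal ?_
      have h5 : (N.card : ℝ) ≤ Real.exp (κ / 2 * m) := by
        calc (N.card : ℝ) ≤ 5 ^ n := by exact_mod_cast hNcard
          _ = Real.exp (n * Real.log 5) := by
            rw [Real.exp_nat_mul, Real.exp_log (by norm_num)]
          _ ≤ _ := by
            rw [Real.exp_le_exp]
            rw [div_mul_eq_mul_div, div_le_iff₀ hκ] at hnm
            linarith
      calc (N.card : ℝ) * (2 * Real.exp (-κ * m))
          ≤ Real.exp (κ / 2 * m) * (2 * Real.exp (-κ * m)) := by gcongr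
        _ = 2 * (Real.exp (κ / 2 * m) * Real.exp (-κ * m)) := by ring
        _ = _ := by rw [← Real.exp_add]; congr 2; ring

end RandomMatrix

/-! ### Numerical bounds on truncated Gaussian moments -/

section Moments

/-- The truncated second moment `𝔼 z² 1(|z| ≤ 3)` of a standard normal variable `z`. -/
noncomputable def alpha0 : ℝ :=
  ∫ z, {z : ℝ | |z| ≤ 3}.indicator (fun z => z ^ 2) z ∂(gaussianReal 0 1)

theorem measurableSet_abs_le (r : ℝ) : MeasurableSet {z : ℝ | |z| ≤ r} :=
  measurableSet_le (by fun_prop) (by fun_prop)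

theorem integral_indicator_gaussianReal (f : ℝ → ℝ) :
    ∫ z, {z : ℝ | |z| ≤ 3}.indicator f z ∂(gaussianReal 0 1) =
      ∫ z in (-3 : ℝ)..3, gaussianPDFReal 0 1 z * f z := by
  rw [integral_gaussianReal_eq_integral_smul one_ne_zero, intervalIntegral.integral_of_le
    (by norm_num), ← integral_Icc_eq_integral_Ioc, ← integral_indicator measurableSet_Icc]
  have hs : {z : ℝ | |z| ≤ 3} = Set.Icc (-3) 3 := by ext z; simp [abs_le]
  rw [hs]
  congr 1
  ext z
  simp [Set.indicator_apply]

theorem gaussianPDFReal_zero_one (z : ℝ) :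
    gaussianPDFReal 0 1 z = (√(2 * Real.pi))⁻¹ * Real.exp (-z ^ 2 / 2) := by
  simp [gaussianPDFReal]

theorem hasDerivAt_gaussianPDFReal (z : ℝ) :
    HasDerivAt (gaussianPDFReal 0 1) (-z * gaussianPDFReal 0 1 z) z := by
  have e : gaussianPDFReal 0 1 = fun z => (√(2 * Real.pi))⁻¹ * Real.exp (-z ^ 2 / 2) :=
    funext gaussianPDFReal_zero_one
  rw [e]
  have h : HasDerivAt (fun z : ℝ => -z ^ 2 / 2) (-z) z := by
    refine (((hasDerivAt_pow 2 z).fun_neg).div_const 2).congr_deriv ?_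
    norm_num
    ring
  refine (h.exp.const_mul (√(2 * Real.pi))⁻¹).congr_deriv ?_
  ring

theorem continuous_gaussianPDFReal : Continuous (gaussianPDFReal 0 1) :=
  continuous_iff_continuousAt.2 fun z => (hasDerivAt_gaussianPDFReal z).continuousAt

theorem gaussianPDFReal_neg_three : gaussianPDFReal 0 1 (-3) = gaussianPDFReal 0 1 3 := by
  simp [gaussianPDFReal]

/-- Integration by parts with `φ' = -zφ`. It reduces `α₀` and `β₀` to the mass of `[-3, 3]` and the
density `φ(3)`. -/
theorem integral_pow_succ_succ_gaussianPDFReal (k : ℕ) :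
    ∫ z in (-3 : ℝ)..3, gaussianPDFReal 0 1 z * z ^ (k + 2) =
      (k + 1) * (∫ z in (-3 : ℝ)..3, gaussianPDFReal 0 1 z * z ^ k) -
        (3 ^ (k + 1) - (-3) ^ (k + 1)) * gaussianPDFReal 0 1 3 := by
  have hc := continuous_gaussianPDFReal
  have hd : ∀ z ∈ Set.uIcc (-3 : ℝ) 3, HasDerivAt (fun z => gaussianPDFReal 0 1 z * z ^ (k + 1))
      ((k + 1) * (gaussianPDFReal 0 1 z * z ^ k) - gaussianPDFReal 0 1 z * z ^ (k + 2)) z := by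
    intro z _
    refine ((hasDerivAt_gaussianPDFReal z).fun_mul (hasDerivAt_pow (k + 1) z)).congr_deriv ?_
    simp
    ring
  have h := intervalIntegral.integral_eq_sub_of_hasDerivAt hd
    (Continuous.intervalIntegrable (by fun_prop) _ _)
  rw [intervalIntegral.integral_sub (Continuous.intervalIntegrable (by fun_prop) _ _)
    (Continuous.intervalIntegrable (by fun_prop) _ _), intervalIntegral.integral_const_mul,
    gaussianPDFReal_neg_three] at h
  linarith

theorem alpha0_eq : alpha0 = (∫ z in (-3 : ℝ)..3, gaussianPDFReal 0 1 z) -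
    6 * gaussianPDFReal 0 1 3 := by
  have := integral_pow_succ_succ_gaussianPDFReal 0
  rw [alpha0, integral_indicator_gaussianReal, this]
  norm_num

theorem beta0_eq : beta0 = 3 * (∫ z in (-3 : ℝ)..3, gaussianPDFReal 0 1 z) -
    72 * gaussianPDFReal 0 1 3 := by
  have h2 := integral_pow_succ_succ_gaussianPDFReal 2
  have h0 := integral_pow_succ_succ_gaussianPDFReal 0
  rw [beta0, integral_indicator_gaussianReal, h2, h0]
  norm_num
  ring

theorem exp_neg_nine_bounds : Real.exp (-9) < 0.0001235 ∧ 0.0001233 < Real.exp (-9) := by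
  have h1 := Real.exp_one_gt_d9
  have h2 := Real.exp_one_lt_d9
  have e : Real.exp 9 = Real.exp 1 ^ 9 := by rw [← Real.exp_nat_mul]; norm_num
  have l : (2.7182818283 : ℝ) ^ 9 < Real.exp 9 := by rw [e]; gcongr
  have u : Real.exp 9 < (2.7182818286 : ℝ) ^ 9 := by rw [e]; gcongr
  rw [Real.exp_neg]
  constructor
  · rw [inv_lt_comm₀ (Real.exp_pos _) (by norm_num)]
    refine lt_trans ?_ l; norm_num
  · rw [lt_inv_comm₀ (by norm_num) (Real.exp_pos _)]
    refine u.trans ?_; norm_num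

theorem gaussianPDFReal_three_bounds :
    0.0043 < gaussianPDFReal 0 1 3 ∧ gaussianPDFReal 0 1 3 < 0.0045 := by
  have hsq : gaussianPDFReal 0 1 3 ^ 2 = Real.exp (-9) / (2 * Real.pi) := by
    rw [gaussianPDFReal_zero_one, mul_pow, inv_pow, Real.sq_sqrt (by positivity),
      ← Real.exp_nat_mul]
    norm_num
    ring
  obtain ⟨hu, hl⟩ := exp_neg_nine_bounds
  have hp1 := Real.pi_gt_d2
  have hp2 := Real.pi_lt_d2
  have hpos := gaussianPDFReal_nonneg 0 1 3
  constructor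
  · refine lt_of_pow_lt_pow_left₀ 2 hpos ?_
    rw [hsq, lt_div_iff₀ (by positivity)]
    nlinarith
  · refine lt_of_pow_lt_pow_left₀ 2 (by norm_num) ?_
    rw [hsq, div_lt_iff₀ (by positivity)]
    nlinarith

/-- The Chernoff tail bound `2 e^{-9/2}` is already sharp enough. -/
theorem integral_gaussianPDFReal_bounds :
    0.977 ≤ ∫ z in (-3 : ℝ)..3, gaussianPDFReal 0 1 z ∧
      ∫ z in (-3 : ℝ)..3, gaussianPDFReal 0 1 z ≤ 1 := by
  have h := integral_indicator_gaussianReal (fun _ => 1)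
  simp only [mul_one] at h
  rw [← h, integral_indicator_const _ (measurableSet_abs_le 3)]
  simp only [smul_eq_mul, mul_one]
  refine ⟨?_, measureReal_le_one⟩
  have hexp : Real.exp (-(9 / 2)) ≤ 0.0115 := by
    refine le_of_sq_le_sq ?_ (by norm_num)
    rw [← Real.exp_nat_mul]
    norm_num
    have := exp_neg_nine_bounds.1
    norm_num at this
    linarith
  have hup := measure_ge_le_exp_mul_mgf (μ := gaussianReal 0 1) (X := id) (t := 3) 3 (by norm_num)
    (integrable_exp_mul_gaussianReal 3)
  have hlo := measure_le_le_exp_mul_mgf (μ := gaussianReal 0 1) (X := id) (t := -3) (-3)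
    (by norm_num) (integrable_exp_mul_gaussianReal (-3))
  rw [mgf_id_gaussianReal] at hup hlo
  rw [← Real.exp_add] at hup hlo
  norm_num at hup hlo
  have hcompl := probReal_compl_eq_one_sub (μ := gaussianReal 0 1) (measurableSet_abs_le 3)
  have hsub : {z : ℝ | |z| ≤ 3}ᶜ ⊆ {z | 3 ≤ z} ∪ {z | z ≤ -3} := by
    intro z hz
    simp only [Set.mem_compl_iff, Set.mem_ofPred_eq, not_le, lt_abs] at hz
    rcases hz with h | h
    · left; exact h.le
    · right; simp only [Set.mem_ofPred_eq]; linarith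
  have h1 := measureReal_mono (μ := gaussianReal 0 1) hsub
  have h2 := measureReal_union_le (μ := gaussianReal 0 1) {z | 3 ≤ z} {z | z ≤ -3}
  linarith

/-- With `p` the mass of `[-3, 3]`, `β₀ - α₀ = 2p - 66 φ(3)`, which the bounds place between `1.657`
and `1.717`. -/
theorem abs_beta0_sub_alpha0_sub_le : |beta0 - alpha0 - 17 / 10| ≤ 1 / 20 := by
  obtain ⟨h1, h2⟩ := integral_gaussianPDFReal_bounds
  obtain ⟨h3, h4⟩ := gaussianPDFReal_three_bounds
  rw [alpha0_eq, beta0_eq, abs_le]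
  norm_num at *
  constructor <;> linarith

/-- The coefficient function takes values in `[-β₀, 9 - β₀]`, so this range is what makes `7` a
valid sup bound. -/
theorem beta0_mem_Icc : beta0 ∈ Set.Icc (2 : ℝ) 7 := by
  obtain ⟨h1, h2⟩ := integral_gaussianPDFReal_bounds
  obtain ⟨h3, h4⟩ := gaussianPDFReal_three_bounds
  rw [beta0_eq]
  norm_num at *
  constructor <;> linarith

end Moments

/-! ### The mean of the weighted sample matrix -/

section Mean

open scoped RealInnerProductSpace

variable {n : ℕ}

theorem memLp_inner_stdGaussian (v : EuclideanSpace ℝ (Fin n)) :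
    MemLp (fun x => ⟪v, x⟫) 2 (stdGaussian (EuclideanSpace ℝ (Fin n))) :=
  IsGaussian.memLp_two_id.continuousLinearMap_comp (innerSL ℝ v)

theorem integral_inner_stdGaussian (v : EuclideanSpace ℝ (Fin n)) :
    ∫ x, ⟪v, x⟫ ∂(stdGaussian (EuclideanSpace ℝ (Fin n))) = 0 :=
  integral_strongDual_stdGaussian (innerSL ℝ v)

theorem covariance_inner_stdGaussian (v w : EuclideanSpace ℝ (Fin n)) :
    cov[fun x => ⟪v, x⟫, fun x => ⟪w, x⟫; stdGaussian (EuclideanSpace ℝ (Fin n))] = ⟪v, w⟫ := by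
  rw [← covarianceBilin_apply_eq_cov IsGaussian.memLp_two_id, covarianceBilin_stdGaussian,
    innerSL_apply_apply]

theorem integral_inner_sq_stdGaussian (v : EuclideanSpace ℝ (Fin n)) :
    ∫ x, ⟪v, x⟫ ^ 2 ∂(stdGaussian (EuclideanSpace ℝ (Fin n))) = ‖v‖ ^ 2 := by
  rw [← real_inner_self_eq_norm_sq, ← covariance_inner_stdGaussian, covariance_self (by fun_prop),
    variance_of_integral_eq_zero (by fun_prop) (integral_inner_stdGaussian v)]

theorem indepFun_inner_stdGaussian {v w : EuclideanSpace ℝ (Fin n)} (h : ⟪v, w⟫ = 0) :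
    IndepFun (fun x => ⟪v, x⟫) (fun x => ⟪w, x⟫) (stdGaussian (EuclideanSpace ℝ (Fin n))) := by
  refine HasGaussianLaw.indepFun_of_covariance_eq_zero ?_ (by rw [covariance_inner_stdGaussian, h])
  exact IsGaussian.hasGaussianLaw_id.map_of_measurable ((innerSL ℝ v).prod (innerSL ℝ w))
    (by fun_prop)

/-- Write `v = s u + w` with `w ⊥ u`. Then `⟪u, x⟫` and `⟪w, x⟫` are uncorrelated and jointly
Gaussian, hence independent, and the cross term vanishes because `⟪w, x⟫` is centred. -/
theorem integral_mul_inner_sq_stdGaussian {g : ℝ → ℝ} (hg : Measurable g) {B : ℝ}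
    (hB : ∀ z, |g z| ≤ B) {u : EuclideanSpace ℝ (Fin n)} (hu : ‖u‖ = 1)
    (v : EuclideanSpace ℝ (Fin n)) :
    ∫ x, g ⟪x, u⟫ * ⟪x, v⟫ ^ 2 ∂(stdGaussian (EuclideanSpace ℝ (Fin n))) =
      ⟪u, v⟫ ^ 2 * (∫ z, g z * z ^ 2 ∂(gaussianReal 0 1)) +
        (‖v‖ ^ 2 - ⟪u, v⟫ ^ 2) * ∫ z, g z ∂(gaussianReal 0 1) := by
  set μ := stdGaussian (EuclideanSpace ℝ (Fin n))
  set s := ⟪u, v⟫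
  set w := v - s • u with hw
  have huu : ⟪u, u⟫ = 1 := by rw [real_inner_self_eq_norm_sq, hu, one_pow]
  have huw : ⟪u, w⟫ = 0 := by
    rw [hw, inner_sub_right, inner_smul_right, huu]; ring
  have hww : ‖w‖ ^ 2 = ‖v‖ ^ 2 - s ^ 2 := by
    rw [hw, norm_sub_sq_real, norm_smul, inner_smul_right, real_inner_comm, hu, mul_one,
      Real.norm_eq_abs, sq_abs]
    ring
  have hlaw : ∀ {f : ℝ → ℝ}, Measurable f → ∫ x, f ⟪u, x⟫ ∂μ = ∫ z, f z ∂(gaussianReal 0 1) := by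
    intro f hf
    have := (hasLaw_inner_stdGaussian hu).integral_comp hf.aestronglyMeasurable
    simpa only [Function.comp_def, real_inner_comm] using this
  have hgu : Measurable fun x => g ⟪u, x⟫ := hg.comp (by fun_prop)
  have hbdd : ∀ {f : EuclideanSpace ℝ (Fin n) → ℝ}, Integrable f μ →
      Integrable (fun x => g ⟪u, x⟫ * f x) μ := fun hf =>
    hf.bdd_mul (c := B) hgu.aestronglyMeasurable (ae_of_all _ fun x => hB _)
  have hind := indepFun_inner_stdGaussian huw
  have hz := memLp_inner_stdGaussian u
  have hy := memLp_inner_stdGaussian w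
  have i1 := (hbdd hz.integrable_sq).const_mul (s ^ 2)
  have i2 : Integrable (fun x => 2 * s * (g ⟪u, x⟫ * (⟪u, x⟫ * ⟪w, x⟫))) μ :=
    (hbdd (hz.integrable_mul hy)).const_mul (2 * s)
  have i3 := hbdd hy.integrable_sq
  have e : ∀ x, g ⟪x, u⟫ * ⟪x, v⟫ ^ 2 = s ^ 2 * (g ⟪u, x⟫ * ⟪u, x⟫ ^ 2) +
      2 * s * (g ⟪u, x⟫ * (⟪u, x⟫ * ⟪w, x⟫)) + g ⟪u, x⟫ * ⟪w, x⟫ ^ 2 := by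
    intro x
    have : ⟪x, v⟫ = s * ⟪u, x⟫ + ⟪w, x⟫ := by
      rw [hw, inner_sub_left, real_inner_smul_left, real_inner_comm x v]; ring
    rw [this, real_inner_comm]
    ring
  have e2 : ∫ x, g ⟪u, x⟫ * (⟪u, x⟫ * ⟪w, x⟫) ∂μ = 0 := by
    have := (hind.comp (φ := fun z => g z * z) (ψ := fun z => z) (by fun_prop)
      measurable_id).integral_fun_mul_eq_mul_integral (by fun_prop) (by fun_prop)
    simp only [Function.comp_def] at this
    simp_rw [← mul_assoc]
    rw [this, integral_inner_stdGaussian, mul_zero]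
  have e3 : ∫ x, g ⟪u, x⟫ * ⟪w, x⟫ ^ 2 ∂μ = (‖v‖ ^ 2 - s ^ 2) * ∫ z, g z ∂(gaussianReal 0 1) := by
    have := (hind.comp (φ := g) (ψ := fun z => z ^ 2) hg
      (by fun_prop)).integral_fun_mul_eq_mul_integral hgu.aestronglyMeasurable (by fun_prop)
    simp only [Function.comp_def] at this
    rw [this, integral_inner_sq_stdGaussian, hlaw hg, hww, mul_comm]
  simp_rw [e]
  rw [integral_add (by exact i1.add i2) i3, integral_add i1 i2, integral_const_mul, integral_const_mul, e2,
    e3, hlaw (f := fun z => g z * z ^ 2) (by fun_prop)]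
  ring

end Mean

/-! ### The truncated coefficients -/

section Truncation

/-- The coefficient function `z ↦ z² 1(|z| ≤ 3) - β₀`. -/
noncomputable def truncFun (z : ℝ) : ℝ := {z : ℝ | |z| ≤ 3}.indicator (fun z => z ^ 2) z - beta0

theorem measurable_indicator_pow (k : ℕ) :
    Measurable ({z : ℝ | |z| ≤ 3}.indicator (fun z => z ^ k)) :=
  Measurable.indicator (by fun_prop) (measurableSet_abs_le 3)

theorem measurable_truncFun : Measurable truncFun :=
  (measurable_indicator_pow 2).sub_const _

theorem abs_indicator_pow_le (k : ℕ) (z : ℝ) :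
    |{z : ℝ | |z| ≤ 3}.indicator (fun z => z ^ k) z| ≤ 3 ^ k := by
  by_cases hz : |z| ≤ 3
  · rw [Set.indicator_of_mem (by exact hz), abs_pow]
    gcongr
  · rw [Set.indicator_of_notMem (by exact hz)]
    simp

theorem integrable_indicator_pow (k : ℕ) :
    Integrable ({z : ℝ | |z| ≤ 3}.indicator (fun z => z ^ k)) (gaussianReal 0 1) :=
  Integrable.of_bound (measurable_indicator_pow k).aestronglyMeasurable (3 ^ k)
    (ae_of_all _ (abs_indicator_pow_le k))

theorem abs_truncFun_le (z : ℝ) : |truncFun z| ≤ 7 := by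
  have h := abs_indicator_pow_le 2 z
  have h0 : 0 ≤ {z : ℝ | |z| ≤ 3}.indicator (fun z => z ^ 2) z :=
    Set.indicator_nonneg (fun _ _ => sq_nonneg _) z
  obtain ⟨h1, h2⟩ := beta0_mem_Icc
  rw [abs_le] at h
  rw [truncFun, abs_le]
  constructor <;> linarith [h.2]

theorem integral_truncFun : ∫ z, truncFun z ∂(gaussianReal 0 1) = alpha0 - beta0 := by
  simp only [truncFun]
  rw [integral_sub (integrable_indicator_pow 2) (integrable_const _)]
  simp [alpha0]

/-- This is what fixes `β₀`: since `𝔼 z² = 1`, subtracting it removes the `x₀x₀ᵀ` component of the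
mean. -/
theorem integral_truncFun_mul_sq : ∫ z, truncFun z * z ^ 2 ∂(gaussianReal 0 1) = 0 := by
  have h2 : Integrable (fun z : ℝ => z ^ 2) (gaussianReal 0 1) :=
    (IsGaussian.memLp_two_id (μ := gaussianReal 0 1)).integrable_sq
  have hv : ∫ z, z ^ 2 ∂(gaussianReal 0 1) = 1 := by
    have := variance_of_integral_eq_zero (μ := gaussianReal 0 1) (X := fun z => z) (by fun_prop)
      integral_id_gaussianReal
    rw [← this, variance_fun_id_gaussianReal]
    simp
  have e : ∀ z : ℝ, truncFun z * z ^ 2 =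
      {z : ℝ | |z| ≤ 3}.indicator (fun z => z ^ 4) z - beta0 * z ^ 2 := by
    intro z
    simp only [truncFun, Set.indicator_apply]
    split_ifs <;> ring
  simp_rw [e]
  rw [integral_sub (integrable_indicator_pow 4) (h2.const_mul _), integral_const_mul, hv, beta0]
  simp

theorem truncCoeff_eq {n m : ℕ} (a : Fin m → EuclideanSpace ℝ (Fin n))
    (x₀ : EuclideanSpace ℝ (Fin n)) :
    truncCoeff a x₀ = fun i => 1 / (m : ℝ) * truncFun (inner ℝ (a i) x₀) := rfl

theorem norm_truncCoeff_le {n m : ℕ} (a : Fin m → EuclideanSpace ℝ (Fin n))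
    (x₀ : EuclideanSpace ℝ (Fin n)) : ‖truncCoeff a x₀‖ ≤ 7 / m := by
  refine (pi_norm_le_iff_of_nonneg (by positivity)).2 fun i => ?_
  rw [truncCoeff_eq, Real.norm_eq_abs, abs_mul, abs_of_nonneg (by positivity), one_div,
    inv_mul_eq_div]
  gcongr
  exact abs_truncFun_le _

theorem isSymm_smul_one_sub_vecMulVec {n : ℕ} (r : ℝ) (p : Fin n → ℝ) :
    (r • ((1 : Matrix (Fin n) (Fin n) ℝ) - Matrix.vecMulVec p p)).IsSymm := by
  rw [Matrix.IsSymm, Matrix.transpose_smul, Matrix.transpose_sub, Matrix.transpose_vecMulVec,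
    Matrix.transpose_one]

-- The budget `1/10` is split evenly between random fluctuation and the numerical error in `β₀ - α₀
-- ≈ 17/10`.
open scoped Matrix.Norms.L2Operator in
theorem isCertificate_of_spectralNorm_sub_le {n : ℕ} {x₀ : EuclideanSpace ℝ (Fin n)}
    (hx₀ : ‖x₀‖ = 1) {Y : Matrix (Fin n) (Fin n) ℝ} (hY : Y.IsSymm)
    (h : spectralNorm (Y - (alpha0 - beta0) • (1 - Matrix.vecMulVec x₀.ofLp x₀.ofLp)) ≤ 1 / 20) :
    IsCertificate x₀ Y := by
  refine isCertificate_of_spectralNorm_le hx₀ hY ?_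
  set P := (1 : Matrix (Fin n) (Fin n) ℝ) - Matrix.vecMulVec x₀.ofLp x₀.ofLp
  have h₀ : x₀.ofLp ⬝ᵥ x₀.ofLp = 1 := dotProduct_self_eq_one hx₀
  have e : Y + (17 / 10 : ℝ) • P =
      (Y - (alpha0 - beta0) • P) + (-(beta0 - alpha0 - 17 / 10)) • P := by
    module
  rw [spectralNorm] at h ⊢
  calc ‖Y + (17 / 10 : ℝ) • P‖ ≤ ‖Y - (alpha0 - beta0) • P‖ +
        ‖(-(beta0 - alpha0 - 17 / 10)) • P‖ := by rw [e]; exact norm_add_le _ _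
    _ ≤ 1 / 20 + 1 / 20 * 1 := by
      rw [norm_smul, norm_neg, Real.norm_eq_abs]
      gcongr
      · exact abs_beta0_sub_alpha0_sub_le
      · exact norm_one_sub_vecMulVec_le h₀
    _ = 1 / 10 := by norm_num

theorem dotProduct_one_sub_vecMulVec_mulVec {n : ℕ} (u v : EuclideanSpace ℝ (Fin n)) :
    v.ofLp ⬝ᵥ ((1 : Matrix (Fin n) (Fin n) ℝ) - Matrix.vecMulVec u.ofLp u.ofLp).mulVec v =
      ‖v‖ ^ 2 - inner ℝ u v ^ 2 := by
  have h : inner ℝ u v = v.ofLp ⬝ᵥ u.ofLp := by simp [PiLp.inner_apply, dotProduct]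
  rw [Matrix.sub_mulVec, Matrix.one_mulVec, Matrix.vecMulVec_mulVec, dotProduct_sub,
    dotProduct_smul, EuclideanSpace.real_norm_sq_eq, h, dotProduct_comm u.ofLp]
  simp [dotProduct, sq]

end Truncation

end PhaseLift

open PhaseLift in
/-- The probability statements bound the (outer) probability of failure by `C e^{-γ m}`. The norm
on `Fin m → ℝ` is the sup norm. -/
theorem lemma3 :
    ∃ c : ℝ, 0 < c ∧ ∃ C : ℝ, 0 < C ∧ ∃ γ : ℝ, 0 < γ ∧
      ∀ (n m : ℕ), c * (n : ℝ) ≤ (m : ℝ) →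
      ∀ (Ω : Type*) [MeasurableSpace Ω] (P : Measure Ω) [IsProbabilityMeasure P]
        (a : Fin m → Ω → EuclideanSpace ℝ (Fin n)),
        (∀ i, HasLaw (a i) (stdGaussian (EuclideanSpace ℝ (Fin n))) P) →
        iIndepFun a P →
        (∀ x₀ : EuclideanSpace ℝ (Fin n),
          P {ω | ¬ ∃ lam : Fin m → ℝ, ‖lam‖ ≤ 7 / (m : ℝ) ∧
              PhaseLift.IsCertificate x₀ (PhaseLift.adjointMap (fun i => a i ω) lam)}
            ≤ ENNReal.ofReal (C * Real.exp (-γ * (m : ℝ)))) ∧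
        (∀ x₀ : EuclideanSpace ℝ (Fin n), ‖x₀‖ = 1 →
          (∀ ω, ‖PhaseLift.truncCoeff (fun i => a i ω) x₀‖ ≤ 7 / (m : ℝ)) ∧
          P {ω | ¬ PhaseLift.IsCertificate x₀ (PhaseLift.adjointMap (fun i => a i ω)
              (PhaseLift.truncCoeff (fun i => a i ω) x₀))}
            ≤ ENNReal.ofReal (C * Real.exp (-γ * (m : ℝ)))) := by
  obtain ⟨c, hc, γ, hγ, hconc⟩ :=
    exists_spectralNorm_concentration (B := 7) (η := 1 / 20) (by norm_num) (by norm_num)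
  refine ⟨c, hc, 2, two_pos, γ, hγ, ?_⟩
  intro n m hnm Ω _ P _ a ha hind
  have hunit : ∀ x₀ : EuclideanSpace ℝ (Fin n), ‖x₀‖ = 1 →
      P {ω | ¬ IsCertificate x₀ (adjointMap (fun i => a i ω) (truncCoeff (fun i => a i ω) x₀))} ≤
        ENNReal.ofReal (2 * Real.exp (-γ * (m : ℝ))) := by
    intro x₀ hx₀
    have hmeas := measurable_truncFun
    refine le_trans (measure_mono fun ω hω => ?_) (hconc n m hnm P a ha hind
      (fun x => truncFun (inner ℝ x x₀))
      ((alpha0 - beta0) • (1 - Matrix.vecMulVec x₀.ofLp x₀.ofLp)) (by fun_prop)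
      (fun x => abs_truncFun_le _) (isSymm_smul_one_sub_vecMulVec _ _) fun v _ => ?_)
    · by_contra hcon
      exact hω (isCertificate_of_spectralNorm_sub_le hx₀ (adjointMap_isSymm _ _) (not_lt.1 hcon))
    · rw [integral_mul_inner_sq_stdGaussian hmeas abs_truncFun_le hx₀, integral_truncFun_mul_sq,
        integral_truncFun, Matrix.smul_mulVec, dotProduct_smul,
        dotProduct_one_sub_vecMulVec_mulVec, smul_eq_mul]
      ring
  refine ⟨fun x₀ => ?_, fun x₀ hx₀ => ⟨fun ω => norm_truncCoeff_le _ _, hunit x₀ hx₀⟩⟩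
  rcases eq_or_ne x₀ 0 with rfl | hx₀
  -- Here `T = 0` and `T^⊥` is all symmetric matrices, so the constant weight `-17/10` has exactly
  -- the target mean.
  · refine le_trans (measure_mono fun ω hω => ?_) (hconc n m hnm P a ha hind
      (fun _ => -(17 / 10)) (-(17 / 10 : ℝ) • 1) measurable_const
      (fun x => by norm_num [abs_of_pos]) (Matrix.isSymm_one.smul _) fun v _ => ?_)
    · by_contra hcon
      refine hω ⟨fun _ => 1 / (m : ℝ) * (-(17 / 10)), ?_,
        isCertificate_zero_of_spectralNorm_le (adjointMap_isSymm _ _) ?_⟩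
      · refine (pi_norm_le_iff_of_nonneg (by positivity)).2 fun i => ?_
        rw [Real.norm_eq_abs, abs_mul, abs_neg, abs_of_nonneg (by positivity),
          abs_of_nonneg (by norm_num), one_div, inv_mul_eq_div]
        gcongr
        norm_num
      · rw [Set.mem_ofPred_eq, not_lt, neg_smul, sub_neg_eq_add] at hcon
        linarith
    · rw [integral_const_mul, Matrix.smul_mulVec, Matrix.one_mulVec, dotProduct_smul]
      simp_rw [real_inner_comm]
      rw [integral_inner_sq_stdGaussian, EuclideanSpace.real_norm_sq_eq]
      simp [dotProduct, sq]
  · have hr : ‖x₀‖⁻¹ ≠ 0 := inv_ne_zero (norm_ne_zero_iff.2 hx₀)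
    -- The witness is the coefficient vector of the normalised `x₀`.
    refine le_trans (measure_mono fun ω hω => ?_) (hunit (‖x₀‖⁻¹ • x₀) (norm_smul_inv_norm hx₀))
    intro hcert
    exact hω ⟨_, norm_truncCoeff_le _ _, (isCertificate_smul_iff x₀ hr _).1 hcert⟩
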